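/- A quandle is a set $X$ with a binary operation $*$ such that, for all $i,j,k\in X$: $i*i=i$; there is a unique $x\in X$ with $x*j=i$; and $(i*j)*k=(i*k)*(j*k)$. For $i\in X$ the right translation $R_i\colon X\to X$, $R_i(j)=j*i$, is then a permutation of $X$, and $X$ is called connected if the group $\langle R_i : i\in X\rangle$ acts transitively on $X$. In a finite connected quandle all right translations have the same cycle structure; its profile is the list $(\ell_1,\dots,\ell_c)$, with $1=\ell_1\le\cdots\le\ell_c$, of the lengths of all disjoint cycles (fixed points included, with repetitions) of any right translation. Theorem 1.4 (Main Theorem). Let $X$ be a finite connected quandle with profile $(\ell_1,\dots,\ell_c)$, where $1=\ell_1\le\cdots\le\ell_c$. If $c\in\{3,4,5\}$, then $\ell_i$ divides $\ell_c$ for every $i\in\{1,\dots,c\}$. -/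

import Mathlib

namespace FiniteQuandle

/-- The right translation `R_x : y ↦ y * x`. Mathlib's quandles are written with the action on the
left, the dictionary being `y * x = x ◃ y`; under it the axioms of `Quandle` are exactly
idempotency, right-invertibility and right self-distributivity of `*`. -/
def rightTranslation {X : Type*} [Quandle X] (x : X) : Equiv.Perm X := Rack.act' x

/-- The right multiplication group `⟨R_x : x ∈ X⟩`. -/
def rightMulGroup (X : Type*) [Quandle X] : Subgroup (Equiv.Perm X) :=
  Subgroup.closure (Set.range (rightTranslation : X → Equiv.Perm X))

/-- A quandle is connected if its right multiplication group acts transitively on it. -/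
def IsConnected (X : Type*) [Quandle X] : Prop :=
  MulAction.IsPretransitive (rightMulGroup X) X

/-- The cycle structure of a permutation `f` of a finite set: the multiset of the lengths of all its
disjoint cycles, with one entry `1` for each fixed point. -/
def cycleStructure {X : Type*} [Fintype X] [DecidableEq X] (f : Equiv.Perm X) : Multiset ℕ :=
  f.partition.parts

/-- `(ℓ_1, …, ℓ_c)` is the profile read off from the right translation by `x`: it lists the lengths
of all cycles of `R_x`, with repetitions and in nondecreasing order. In a connected quandle this
does not depend on `x`. -/
def IsProfile {X : Type*} [Quandle X] [Fintype X] [DecidableEq X] (x : X) {c : ℕ}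
    (ℓ : Fin c → ℕ) : Prop :=
  Monotone ℓ ∧ (Finset.univ : Finset (Fin c)).val.map ℓ = cycleStructure (rightTranslation x)

end FiniteQuandle

namespace FiniteQuandle

/-! Suppose some cycle length `a` of `R_x` does not divide the largest one `N`. A prime `p` whose
exponent is larger in `a` than in `N` yields `k` and `P` (`exists_dvd_or_dvd`) such that `R_x ^ k`
fixes the longest cycle `M` and moves the cycle of length `a`, while every cycle moved by `R_x ^ k`
has length divisible by `P`, and `P ∤ N`.

Two tools exploit this. Fixed sets of powers of `R_x` are subquandles, and a connected quandle is
not the union of two proper ones (`IsConnected.eq_univ_or_eq_univ`). Also, `SamePow k` is an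
equivalence relation invariant under all translations, so its classes are blocks of equal size; the
class of `x` is a union of cycles of `R_x` inside the fixed set of `R_x ^ k`.

Besides `x` and `M` there are at most three cycles. If `R_x ^ k` moves only one, of length `m`, the
fixed sets of `R_x ^ k` and `R_x ^ m` cover `X`. If it moves three, the classes for `k` and `m` meet
only in `x` and are too large for `X` (`false_of_fixes_only`). If it moves two, counting and
divisibility by `P` make the class for `k` stable under all translations, hence equal to `X`
(`false_of_moves_two`). Each case is absurd. -/

theorem mem_iff_of_mapsTo {X : Type*} [Finite X] (f : Equiv.Perm X) {S : Set X}
    (h : ∀ y ∈ S, f y ∈ S) (y : X) : f y ∈ S ↔ y ∈ S := by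
  have hsub : f '' S ⊆ S := by
    rintro _ ⟨z, hz, rfl⟩
    exact h z hz
  have heq : f '' S = S :=
    Set.eq_of_subset_of_ncard_le hsub (Set.ncard_image_of_injective S f.injective).ge S.toFinite
  refine ⟨fun hy => ?_, h y⟩
  rw [← heq] at hy
  exact (f.injective.mem_set_image).1 hy

/-! ### Translations, subquandles and the relations `SamePow k` -/

section Basic

variable {X : Type*} [Quandle X]

theorem rightTranslation_conj (x y : X) :
    rightTranslation (rightTranslation x y) =
      rightTranslation x * rightTranslation y * (rightTranslation x)⁻¹ :=
  Rack.ad_conj x y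

theorem rightTranslation_self (x : X) : rightTranslation x x = x :=
  Quandle.fix

theorem rightTranslation_pow_self (x : X) (k : ℕ) : (rightTranslation x ^ k) x = x := by
  induction k with
  | zero => rfl
  | succ k ih => rw [pow_succ, Equiv.Perm.mul_apply, rightTranslation_self, ih]

theorem rightTranslation_mem (x : X) : rightTranslation x ∈ rightMulGroup X :=
  Subgroup.subset_closure ⟨x, rfl⟩

theorem rightTranslation_apply_of_mem {g : Equiv.Perm X} (hg : g ∈ rightMulGroup X) :
    ∀ y, rightTranslation (g y) = g * rightTranslation y * g⁻¹ := by
  induction hg using Subgroup.closure_induction with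
  | mem g hg =>
    obtain ⟨x, rfl⟩ := hg
    exact rightTranslation_conj x
  | one => simp
  | mul g h _ _ ihg ihh =>
    intro y
    rw [Equiv.Perm.mul_apply, ihg, ihh]
    group
  | inv g _ ih =>
    intro y
    have := ih (g⁻¹ y)
    rw [← Equiv.Perm.mul_apply, mul_inv_cancel, Equiv.Perm.one_apply] at this
    rw [this]
    group

/-- A binary relation on `X` that is preserved by all right translations. -/
def IsInvariantRel (r : X → X → Prop) : Prop :=
  ∀ w y z, r (rightTranslation w y) (rightTranslation w z) ↔ r y z

theorem IsInvariantRel.apply_iff {r : X → X → Prop} (hr : IsInvariantRel r) {g : Equiv.Perm X}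
    (hg : g ∈ rightMulGroup X) : ∀ y z, r (g y) (g z) ↔ r y z := by
  induction hg using Subgroup.closure_induction with
  | mem g hg =>
    obtain ⟨x, rfl⟩ := hg
    exact hr x
  | one => simp
  | mul g h _ _ ihg ihh => exact fun y z => (ihg _ _).trans (ihh _ _)
  | inv g _ ih =>
    intro y z
    simpa using (ih (g⁻¹ y) (g⁻¹ z)).symm

theorem IsConnected.exists_apply_eq (hX : IsConnected X) (x y : X) :
    ∃ g ∈ rightMulGroup X, g x = y := by
  obtain ⟨⟨g, hg⟩, h⟩ := hX.exists_smul_eq x y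
  exact ⟨g, hg, h⟩

/-- By finiteness a set mapped into itself by a permutation is also preserved by the inverse, so the
whole group preserves `S`, and transitivity applies. -/
theorem IsConnected.mem_of_closed [Finite X] (hX : IsConnected X) {S : Set X} {x : X} (hx : x ∈ S)
    (h : ∀ w, ∀ y ∈ S, rightTranslation w y ∈ S) (y : X) : y ∈ S := by
  obtain ⟨g, hg, rfl⟩ := hX.exists_apply_eq x y
  have key : ∀ z, g z ∈ S ↔ z ∈ S := by
    clear hx
    induction hg using Subgroup.closure_induction with
    | mem g hg =>
      obtain ⟨w, rfl⟩ := hg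
      exact mem_iff_of_mapsTo _ (h w)
    | one => simp
    | mul g h _ _ ihg ihh => exact fun z => (ihg _).trans (ihh _)
    | inv g _ ih =>
      intro z
      simpa using (ih (g⁻¹ z)).symm
  exact (key x).2 hx

/-- A connected quandle is not the union of two proper subquandles. -/
theorem IsConnected.eq_univ_or_eq_univ [Finite X] (hX : IsConnected X) {A B : Set X}
    (hA : ∀ a ∈ A, ∀ b ∈ A, rightTranslation a b ∈ A)
    (hB : ∀ a ∈ B, ∀ b ∈ B, rightTranslation a b ∈ B)
    (hAB : ∀ y, y ∈ A ∨ y ∈ B) : A = Set.univ ∨ B = Set.univ := by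
  by_contra! hne
  obtain ⟨q, hq⟩ := (Set.ne_univ_iff_exists_notMem A).1 hne.1
  -- All translations normalise `H`: those by points of `A` permute the complement of `A`, the
  -- others lie in `H`. Connectedness then puts every translation in `H`, which preserves `B`
  -- because the complement of `A` lies in `B`.
  let H : Subgroup (Equiv.Perm X) := Subgroup.closure (rightTranslation '' Aᶜ)
  have hconj : ∀ w, ∀ g ∈ H, rightTranslation w * g * (rightTranslation w)⁻¹ ∈ H := by
    intro w
    by_cases hw : w ∈ A
    · have hle : H ≤ H.comap (MulAut.conj (rightTranslation w)).toMonoidHom := by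
        refine (Subgroup.closure_le _).2 ?_
        rintro _ ⟨z, hz, rfl⟩
        refine Subgroup.subset_closure ⟨rightTranslation w z, ?_, rightTranslation_conj w z⟩
        exact fun hz' => hz ((mem_iff_of_mapsTo _ (hA w hw) z).1 hz')
      exact fun g hg => hle hg
    · have hwH : rightTranslation w ∈ H := Subgroup.subset_closure ⟨w, hw, rfl⟩
      exact fun g hg => H.mul_mem (H.mul_mem hwH hg) (H.inv_mem hwH)
  have hall : ∀ y, rightTranslation y ∈ H := by
    refine hX.mem_of_closed (S := {y | rightTranslation y ∈ H}) (x := q)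
      (Subgroup.subset_closure ⟨q, hq, rfl⟩) fun w y hy => ?_
    change rightTranslation (rightTranslation w y) ∈ H
    rw [rightTranslation_conj]
    exact hconj w _ hy
  have hpres : ∀ g ∈ H, ∀ z, g z ∈ B ↔ z ∈ B := by
    intro g hg
    induction hg using Subgroup.closure_induction with
    | mem g hg =>
      obtain ⟨w, hw, rfl⟩ := hg
      exact mem_iff_of_mapsTo _ (hB w ((hAB w).resolve_left hw))
    | one => simp
    | mul g h _ _ ihg ihh => exact fun z => (ihg _).trans (ihh _)
    | inv g _ ih =>
      intro z
      simpa using (ih (g⁻¹ z)).symm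
  exact hne.2 (Set.eq_univ_of_forall (hX.mem_of_closed ((hAB q).resolve_left hq)
    fun w y hy => (hpres _ (hall w) y).2 hy))

theorem commute_of_pow_apply_eq {x y : X} {k : ℕ} (h : (rightTranslation x ^ k) y = y) :
    Commute (rightTranslation x ^ k) (rightTranslation y) := by
  have := rightTranslation_apply_of_mem (pow_mem (rightTranslation_mem x) k) y
  rw [h] at this
  exact (mul_inv_eq_iff_eq_mul.1 this.symm)

/-- The points whose right translations have the same `k`-th power. -/
def SamePow (k : ℕ) (y z : X) : Prop := rightTranslation y ^ k = rightTranslation z ^ k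

theorem samePow_equivalence (k : ℕ) : Equivalence (SamePow (X := X) k) :=
  ⟨fun _ => rfl, Eq.symm, Eq.trans⟩

theorem samePow_invariant (k : ℕ) : IsInvariantRel (SamePow (X := X) k) := by
  intro w y z
  simp only [SamePow, rightTranslation_conj, conj_pow]
  simp

theorem SamePow.pow_apply_eq {k : ℕ} {x y : X} (h : SamePow k x y) :
    (rightTranslation x ^ k) y = y := by
  rw [show rightTranslation x ^ k = rightTranslation y ^ k from h, rightTranslation_pow_self]

/-- Since `R_x ^ k` is an automorphism fixing `y`, it commutes with `R_y`; conjugating `R_x` by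
`R_y` therefore leaves its `k`-th power unchanged. -/
theorem samePow_apply {k : ℕ} {x y : X} (h : (rightTranslation x ^ k) y = y) :
    SamePow k x (rightTranslation y x) := by
  have hc := commute_of_pow_apply_eq h
  rw [SamePow, rightTranslation_conj, conj_pow, ← hc.eq, mul_inv_cancel_right]

theorem samePow_apply_of_samePow {k : ℕ} {x y z : X} (h : (rightTranslation x ^ k) y = y)
    (hz : SamePow k x z) : SamePow k x (rightTranslation y z) :=
  (samePow_equivalence k).trans (samePow_apply h) ((samePow_invariant k y x z).2 hz)

theorem pow_apply_closed (x : X) (k : ℕ) {a b : X} (ha : (rightTranslation x ^ k) a = a)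
    (hb : (rightTranslation x ^ k) b = b) :
    (rightTranslation x ^ k) (rightTranslation a b) = rightTranslation a b := by
  rw [← Equiv.Perm.mul_apply, (commute_of_pow_apply_eq ha).eq, Equiv.Perm.mul_apply, hb]

/-- Two powers of a right translation that both move some point both move a common point. -/
theorem IsConnected.exists_moved_by_both [Finite X] (hX : IsConnected X) {x : X} {k m : ℕ}
    (hk : ∃ y, (rightTranslation x ^ k) y ≠ y) (hm : ∃ y, (rightTranslation x ^ m) y ≠ y) :
    ∃ y, (rightTranslation x ^ k) y ≠ y ∧ (rightTranslation x ^ m) y ≠ y := by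
  by_contra! hne
  rcases hX.eq_univ_or_eq_univ (A := {y | (rightTranslation x ^ k) y = y})
    (B := {y | (rightTranslation x ^ m) y = y}) (fun a ha b hb => pow_apply_closed x k ha hb)
    (fun a ha b hb => pow_apply_closed x m ha hb)
    (fun y => or_iff_not_imp_left.2 (hne y)) with h | h
  · obtain ⟨y, hy⟩ := hk
    exact hy (h.ge (Set.mem_univ y))
  · obtain ⟨y, hy⟩ := hm
    exact hy (h.ge (Set.mem_univ y))

theorem fixed_invariant : IsInvariantRel fun y z : X => rightTranslation y z = z := by
  intro w y z
  simp [rightTranslation_conj]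

/-- A class of `SamePow k` that misses a fixed point `y` of `R_x ^ k` yields another class, not
containing `x`, that is preserved by `R_x`. -/
theorem IsConnected.exists_preserved_class (hX : IsConnected X) {k : ℕ} {x y : X}
    (hy : (rightTranslation x ^ k) y = y) (hxy : ¬ SamePow k x y) :
    ∃ w, ¬ SamePow k x w ∧ ∀ z, SamePow k w z → SamePow k w (rightTranslation x z) := by
  obtain ⟨g, hg, hgy⟩ := hX.exists_apply_eq y x
  have hinv := (samePow_invariant (X := X) k).apply_iff hg
  -- `R_y` preserves the class of `x`; transporting by `g`, which takes `y` to `x`, `R_x` preserves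
  -- the class of `g x`.
  refine ⟨g x, fun h => hxy ?_, fun z hz => ?_⟩
  · have h' : SamePow k (g y) (g x) := by rwa [hgy]
    exact ((hinv y x).1 h').symm
  · have h1 : SamePow k (g x) (rightTranslation x (g x)) := by
      rw [← hgy, rightTranslation_apply_of_mem hg, hgy]
      simpa using (hinv _ _).2 (samePow_apply hy)
    exact (samePow_equivalence k).trans h1 ((samePow_invariant k x _ _).2 hz)

theorem IsConnected.samePow_of_forall [Finite X] (hX : IsConnected X) {k : ℕ} {x : X}
    (h : ∀ y, SamePow k x (rightTranslation y x)) (y : X) : SamePow k x y :=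
  hX.mem_of_closed (S := {y | SamePow k x y}) (x := x) rfl
    (fun w y hy => (samePow_equivalence k).trans (h w) ((samePow_invariant k w x y).2 hy)) y

end Basic

/-! ### Counting with invariant relations -/

section Counting

open Finset
open scoped Classical

variable {X : Type*} [Quandle X] [Fintype X]

theorem IsInvariantRel.card_eq (hX : IsConnected X) {r : X → X → Prop} (hr : IsInvariantRel r)
    (x y : X) : #{z | r x z} = #{z | r y z} := by
  obtain ⟨g, hg, rfl⟩ := hX.exists_apply_eq x y
  refine Finset.card_equiv g fun z => ?_
  simp [hr.apply_iff hg]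

/-- Double counting of related pairs: both row sizes and column sizes are constant by transitivity.
-/
theorem IsInvariantRel.card_swap (hX : IsConnected X) {r : X → X → Prop} (hr : IsInvariantRel r)
    (x : X) : #{z | r x z} = #{z | r z x} := by
  have h := sum_card_bipartiteAbove_eq_sum_card_bipartiteBelow r (s := univ) (t := univ)
  have hr' : IsInvariantRel fun y z => r z y := fun w y z => hr w z y
  have h1 : ∑ a : X, #(bipartiteAbove r univ a) = Fintype.card X * #{z | r x z} := by
    have hc : ∀ a, #(bipartiteAbove r univ a) = #{z | r x z} := fun a => hr.card_eq hX a x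
    simp [hc]
  have h2 : ∑ a : X, #(bipartiteBelow r univ a) = Fintype.card X * #{z | r z x} := by
    have hc : ∀ a, #(bipartiteBelow r univ a) = #{z | r z x} := fun a => hr'.card_eq hX a x
    simp [hc]
  rw [h1, h2] at h
  exact Nat.eq_of_mul_eq_mul_left (Fintype.card_pos_iff.2 ⟨x⟩) h

theorem IsInvariantRel.card_dvd_card (hX : IsConnected X) {r s : X → X → Prop}
    (hr : IsInvariantRel r) (hre : Equivalence r) (hse : Equivalence s)
    (hrs : ∀ y z, r y z → s y z) (x : X) : #{z | r x z} ∣ #{z | s x z} := by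
  rw [card_eq_sum_card_image (fun y => ({z | r y z} : Finset X)) ({z | s x z} : Finset X)]
  refine dvd_sum fun b hb => ?_
  obtain ⟨y, hy, rfl⟩ := mem_image.1 hb
  rw [hr.card_eq hX x y]
  refine dvd_of_eq (congrArg card ?_)
  ext z
  simp only [mem_filter, mem_univ, true_and] at hy ⊢
  constructor
  · refine fun hz => ⟨hse.trans hy (hrs _ _ hz), ?_⟩
    ext u
    simp only [mem_filter, mem_univ, true_and]
    exact ⟨fun h => hre.trans hz h, fun h => hre.trans (hre.symm hz) h⟩
  · rintro ⟨-, hz⟩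
    have : z ∈ ({u | r z u} : Finset X) := by simpa using hre.refl z
    rw [hz] at this
    simpa using this

/-- Count pairs `(a, z)` with `r x a` and `s a z`: for fixed `z`, all such `a` lie in one class of
the intersection of `r` and `s`. -/
theorem IsInvariantRel.card_mul_card_le (hX : IsConnected X) {r s : X → X → Prop}
    (hr : IsInvariantRel r) (hs : IsInvariantRel s) (hre : Equivalence r) (hse : Equivalence s)
    (x : X) :
    #{z | r x z} * #{z | s x z} ≤ Fintype.card X * #{z | r x z ∧ s x z} := by
  have hrs : IsInvariantRel fun y z => r y z ∧ s y z := fun w y z => and_congr (hr w y z) (hs w y z)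
  have h := sum_card_bipartiteAbove_eq_sum_card_bipartiteBelow s
    (s := ({z | r x z} : Finset X)) (t := univ)
  have h1 : ∑ a ∈ ({z | r x z} : Finset X), #(bipartiteAbove s univ a) =
      #{z | r x z} * #{z | s x z} := by
    have hc : ∀ a, #(bipartiteAbove s univ a) = #{z | s x z} := fun a => hs.card_eq hX a x
    simp [hc]
  rw [← h1, h, ← card_univ, ← smul_eq_mul]
  refine sum_le_card_nsmul _ _ _ fun z _ => ?_
  rcases (bipartiteBelow s ({z | r x z} : Finset X) z).eq_empty_or_nonempty with he | ⟨u, hu⟩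
  · simp [he]
  · refine (card_le_card (t := {v | r u v ∧ s u v}) fun v hv => ?_).trans
      (le_of_eq (by convert hrs.card_eq hX u x))
    simp only [bipartiteBelow, mem_filter, mem_univ, true_and] at hu hv ⊢
    exact ⟨hre.trans (hre.symm hu.1) hv.1, hse.trans hu.2 (hse.symm hv.2)⟩

/-- If `R_x ^ k` fixes a point that `R_x` moves, the class of `x` under `SamePow k` is not `{x}`. -/
theorem IsConnected.exists_samePow_ne (hX : IsConnected X) {k : ℕ} {x y : X}
    (hy : (rightTranslation x ^ k) y = y) (hxy : rightTranslation x y ≠ y) :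
    ∃ z, z ≠ x ∧ SamePow k x z := by
  by_contra! hne
  -- With a trivial class, each `z` fixed by `R_x ^ k` has `R_z x = x`. By `card_swap` there are
  -- only as many such `z` as fixed points of `R_x`, but `y` is an extra fixed point of `R_x ^ k`.
  have hsub : ({z | (rightTranslation x ^ k) z = z} : Finset X) ⊆
      ({z | rightTranslation z x = x} : Finset X) := by
    intro z hz
    simp only [mem_filter, mem_univ, true_and] at hz ⊢
    by_contra h
    exact hne _ h (samePow_apply hz)
  have hlt : ({z | rightTranslation x z = z} : Finset X) ⊂
      ({z | (rightTranslation x ^ k) z = z} : Finset X) := by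
    refine (ssubset_iff_of_subset fun z hz => ?_).2 ⟨y, by simpa using hy, by simpa using hxy⟩
    simp only [mem_filter, mem_univ, true_and] at hz ⊢
    exact Equiv.Perm.pow_apply_eq_self_of_apply_eq_self hz k
  have := (card_lt_card hlt).trans_le (card_le_card hsub)
  exact this.ne (fixed_invariant.card_swap hX x)

end Counting

end FiniteQuandle

namespace FiniteQuandle

open Finset
open scoped Classical

theorem card_inter_eq_zero {X : Type*} {O S : Finset X} (h : Disjoint O S) : #(O ∩ S) = 0 := by
  rw [disjoint_iff_inter_eq_empty.1 h, card_empty]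

/-- A set that is contained in or disjoint from every set preserved by `f`: a cycle, or empty. -/
def IsMinimalFor {X : Type*} (f : Equiv.Perm X) (O : Finset X) : Prop :=
  ∀ S : Finset X, (∀ y ∈ S, f y ∈ S) → O ⊆ S ∨ Disjoint O S

theorem IsMinimalFor.card_inter {X : Type*} {f : Equiv.Perm X} {O S : Finset X}
    (h : IsMinimalFor f O) (hS : ∀ y ∈ S, f y ∈ S) :
    O ⊆ S ∧ #(O ∩ S) = #O ∨ Disjoint O S ∧ #(O ∩ S) = 0 :=
  (h S hS).imp (fun h => ⟨h, by rw [inter_eq_left.2 h]⟩) fun h => ⟨h, card_inter_eq_zero h⟩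

/-! ### Classes of `SamePow k` as finite sets -/

section PowClass

variable {X : Type*} [Quandle X] [Fintype X]

/-- The class of `x` under `SamePow k`. -/
noncomputable def powClass (k : ℕ) (x : X) : Finset X := {z | SamePow k x z}

@[simp]
theorem mem_powClass {k : ℕ} {x y : X} : y ∈ powClass k x ↔ SamePow k x y := by
  simp [powClass]

theorem self_mem_powClass (k : ℕ) (x : X) : x ∈ powClass k x :=
  mem_powClass.2 rfl

theorem powClass_closed (x : X) (k : ℕ) : ∀ y ∈ powClass k x, rightTranslation x y ∈ powClass k x :=
  fun _ hy => mem_powClass.2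
    (samePow_apply_of_samePow (rightTranslation_pow_self x k) (mem_powClass.1 hy))

theorem disjoint_powClass {k : ℕ} {x : X} {O : Finset X}
    (h : ∀ y ∈ O, (rightTranslation x ^ k) y ≠ y) : Disjoint O (powClass k x) :=
  disjoint_left.2 fun y hy hy' => h y hy (mem_powClass.1 hy').pow_apply_eq

theorem card_powClass_mul_le (hX : IsConnected X) (x : X) (k m : ℕ) :
    #(powClass k x) * #(powClass m x) ≤
      Fintype.card X * #(powClass k x ∩ powClass m x) := by
  have h := (samePow_invariant k).card_mul_card_le hX (samePow_invariant m)
    (samePow_equivalence k) (samePow_equivalence m) x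
  rw [powClass, powClass, ← filter_and]
  convert h

theorem card_powClass_eq (hX : IsConnected X) (k : ℕ) (x y : X) :
    #(powClass k x) = #(powClass k y) :=
  (samePow_invariant k).card_eq hX x y

theorem card_powClass_dvd (hX : IsConnected X) (x : X) (k : ℕ) :
    #(powClass k x) ∣ Fintype.card X := by
  have h := (samePow_invariant k).card_dvd_card hX (samePow_equivalence k)
    (s := fun _ _ => True) ⟨fun _ => trivial, fun _ => trivial, fun _ _ => trivial⟩
    (fun _ _ _ => trivial) x
  simpa [powClass] using h

theorem card_powClass_inter_dvd (hX : IsConnected X) (x : X) (k m : ℕ) :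
    #(powClass k x ∩ powClass m x) ∣ #(powClass m x) := by
  have hinv : IsInvariantRel fun y z : X => SamePow k y z ∧ SamePow m y z := fun w y z =>
    and_congr (samePow_invariant k w y z) (samePow_invariant m w y z)
  have h := hinv.card_dvd_card hX
    ⟨fun _ => ⟨rfl, rfl⟩, fun h => ⟨h.1.symm, h.2.symm⟩, fun h h' => ⟨h.1.trans h'.1, h.2.trans h'.2⟩⟩
    (samePow_equivalence m) (fun _ _ h => h.2) x
  rw [powClass, powClass, ← filter_and]
  convert h

end PowClass

/-! ### Excluding the possible patterns of moved cycles -/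

section Decomposition

variable {X : Type*} [Quandle X]

/-- A decomposition of a quandle into a point `x` and four further, possibly empty, cycles of the
right translation by `x`. -/
structure IsCycleDecomposition (x : X) (A B D M : Finset X) : Prop where
  cover : ∀ y, y = x ∨ y ∈ A ∨ y ∈ B ∨ y ∈ D ∨ y ∈ M
  disjoint_AB : Disjoint A B
  disjoint_AD : Disjoint A D
  disjoint_AM : Disjoint A M
  disjoint_BD : Disjoint B D
  disjoint_BM : Disjoint B M
  disjoint_DM : Disjoint D M
  notMem_A : x ∉ A
  notMem_B : x ∉ B
  notMem_D : x ∉ D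
  notMem_M : x ∉ M
  minimal_A : IsMinimalFor (rightTranslation x) A
  minimal_B : IsMinimalFor (rightTranslation x) B
  minimal_D : IsMinimalFor (rightTranslation x) D
  minimal_M : IsMinimalFor (rightTranslation x) M

namespace IsCycleDecomposition

variable {x : X} {A B D M : Finset X}

theorem swap (h : IsCycleDecomposition x A B D M) : IsCycleDecomposition x B A D M where
  cover y := by have := h.cover y; tauto
  disjoint_AB := h.disjoint_AB.symm
  disjoint_AD := h.disjoint_BD
  disjoint_AM := h.disjoint_BM
  disjoint_BD := h.disjoint_AD
  disjoint_BM := h.disjoint_AM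
  disjoint_DM := h.disjoint_DM
  notMem_A := h.notMem_B
  notMem_B := h.notMem_A
  notMem_D := h.notMem_D
  notMem_M := h.notMem_M
  minimal_A := h.minimal_B
  minimal_B := h.minimal_A
  minimal_D := h.minimal_D
  minimal_M := h.minimal_M

theorem swap_right (h : IsCycleDecomposition x A B D M) : IsCycleDecomposition x A D B M where
  cover y := by have := h.cover y; tauto
  disjoint_AB := h.disjoint_AD
  disjoint_AD := h.disjoint_AB
  disjoint_AM := h.disjoint_AM
  disjoint_BD := h.disjoint_BD.symm
  disjoint_BM := h.disjoint_DM
  disjoint_DM := h.disjoint_BM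
  notMem_A := h.notMem_A
  notMem_B := h.notMem_D
  notMem_D := h.notMem_B
  notMem_M := h.notMem_M
  minimal_A := h.minimal_A
  minimal_B := h.minimal_D
  minimal_D := h.minimal_B
  minimal_M := h.minimal_M

theorem card_eq (h : IsCycleDecomposition x A B D M) (S : Finset X) :
    #S = (if x ∈ S then 1 else 0) + #(A ∩ S) + #(B ∩ S) + #(D ∩ S) + #(M ∩ S) := by
  have hx : (if x ∈ S then 1 else 0) = #({x} ∩ S) := by
    split_ifs with hx
    · simp [singleton_inter_of_mem hx]
    · simp [singleton_inter_of_notMem hx]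
  have dxA : Disjoint {x} A := disjoint_singleton_left.2 h.notMem_A
  have dxB : Disjoint {x} B := disjoint_singleton_left.2 h.notMem_B
  have dxD : Disjoint {x} D := disjoint_singleton_left.2 h.notMem_D
  have dxM : Disjoint {x} M := disjoint_singleton_left.2 h.notMem_M
  have hu : ({x} ∪ A ∪ B ∪ D ∪ M) ∩ S = S := by
    refine inter_eq_right.2 fun y _ => ?_
    have := h.cover y
    simp only [mem_union, mem_singleton]
    tauto
  conv_lhs => rw [← hu]
  rw [hx, union_inter_distrib_right, card_union_of_disjoint, union_inter_distrib_right,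
    card_union_of_disjoint, union_inter_distrib_right, card_union_of_disjoint,
    union_inter_distrib_right, card_union_of_disjoint]
  · exact dxA.mono inter_subset_left inter_subset_left
  · refine Disjoint.mono inter_subset_left inter_subset_left ?_
    simp only [disjoint_union_left]
    exact ⟨dxB, h.disjoint_AB⟩
  · refine Disjoint.mono inter_subset_left inter_subset_left ?_
    simp only [disjoint_union_left]
    exact ⟨⟨dxD, h.disjoint_AD⟩, h.disjoint_BD⟩
  · refine Disjoint.mono inter_subset_left inter_subset_left ?_
    simp only [disjoint_union_left]
    exact ⟨⟨⟨dxM, h.disjoint_AM⟩, h.disjoint_BM⟩, h.disjoint_DM⟩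

variable [Fintype X]

theorem card_univ_eq (h : IsCycleDecomposition x A B D M) :
    Fintype.card X = 1 + #A + #B + #D + #M := by
  simpa using h.card_eq univ

/-- `R_x ^ k` cannot fix exactly `x` and a cycle `M` longer than each of the other at most three
cycles. -/
theorem false_of_fixes_only (hX : IsConnected X) (h : IsCycleDecomposition x A B D M) {k m : ℕ}
    (hkM : ∀ y ∈ M, (rightTranslation x ^ k) y = y)
    (hkA : ∀ y ∈ A, (rightTranslation x ^ k) y ≠ y)
    (hkB : ∀ y ∈ B, (rightTranslation x ^ k) y ≠ y)
    (hkD : ∀ y ∈ D, (rightTranslation x ^ k) y ≠ y)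
    (hmA : ∀ y ∈ A, (rightTranslation x ^ m) y = y)
    (hmM : ∀ y ∈ M, (rightTranslation x ^ m) y ≠ y)
    (hA : ∃ y ∈ A, rightTranslation x y ≠ y) (hM : ∃ y ∈ M, rightTranslation x y ≠ y)
    (hAM : #A < #M) (hBM : #B < #M) (hDM : #D < #M)
    (hA1 : #A ≠ 1) (hB1 : #B ≠ 1) (hD1 : #D ≠ 1) : False := by
  obtain ⟨a, haA, ha⟩ := hA
  obtain ⟨u, huM, hu⟩ := hM
  obtain ⟨z, hzx, hz⟩ := hX.exists_samePow_ne (hkM u huM) hu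
  obtain ⟨w, hwx, hw⟩ := hX.exists_samePow_ne (hmA a haA) ha
  rw [← mem_powClass] at hz hw
  have hcard := card_powClass_mul_le hX x k m
  have hKx := self_mem_powClass k x
  have hLx := self_mem_powClass m x
  have hdisA := disjoint_powClass hkA
  have hdisB := disjoint_powClass hkB
  have hdisD := disjoint_powClass hkD
  have hdisM := disjoint_powClass hmM
  have hcK := powClass_closed x k
  have hcL := powClass_closed x m
  rw [h.card_univ_eq] at hcard
  have hcov := h.cover
  generalize powClass k x = K at *
  generalize powClass m x = L at *
  have hK := h.card_eq K
  have hL := h.card_eq L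
  have hint : #(K ∩ L) ≤ 1 := by
    refine (card_le_card (t := {x}) fun y hy => ?_).trans (card_singleton x).le
    obtain ⟨hyK, hyL⟩ := mem_inter.1 hy
    rcases hcov y with hy | hy | hy | hy | hy
    · exact mem_singleton.2 hy
    · exact absurd hyK (disjoint_left.1 hdisA hy)
    · exact absurd hyK (disjoint_left.1 hdisB hy)
    · exact absurd hyK (disjoint_left.1 hdisD hy)
    · exact absurd hyL (disjoint_left.1 hdisM hy)
  have hzM : z ∈ M := by
    rcases hcov z with hy | hy | hy | hy | hy
    · exact absurd hy hzx
    · exact absurd hz (disjoint_left.1 hdisA hy)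
    · exact absurd hz (disjoint_left.1 hdisB hy)
    · exact absurd hz (disjoint_left.1 hdisD hy)
    · exact hy
  rw [if_pos hKx, card_inter_eq_zero hdisA, card_inter_eq_zero hdisB,
    card_inter_eq_zero hdisD] at hK
  rw [if_pos hLx, card_inter_eq_zero hdisM] at hL
  have hKM : #(M ∩ K) = #M := by
    rcases h.minimal_M.card_inter hcK with h' | h'
    · exact h'.2
    · exact absurd hz (disjoint_left.1 h'.1 hzM)
  have hS : 2 ≤ #(A ∩ L) + #(B ∩ L) + #(D ∩ L) := by
    have hpos : 1 ≤ #(A ∩ L) + #(B ∩ L) + #(D ∩ L) := by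
      rcases hcov w with hy | hy | hy | hy | hy
      · exact absurd hy hwx
      · have := card_pos.2 ⟨w, mem_inter.2 ⟨hy, hw⟩⟩; omega
      · have := card_pos.2 ⟨w, mem_inter.2 ⟨hy, hw⟩⟩; omega
      · have := card_pos.2 ⟨w, mem_inter.2 ⟨hy, hw⟩⟩; omega
      · exact absurd hw (disjoint_left.1 hdisM hy)
    rcases h.minimal_A.card_inter hcL with h1 | h1 <;>
    rcases h.minimal_B.card_inter hcL with h2 | h2 <;>
    rcases h.minimal_D.card_inter hcL with h3 | h3 <;> omega
  -- At least one of the three cycles lies in `L`, so at most two lie outside, each shorter than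
  -- `M`.
  have hrest : #A + #B + #D < #(A ∩ L) + #(B ∩ L) + #(D ∩ L) + 2 * #M := by
    rcases h.minimal_A.card_inter hcL with h1 | h1 <;>
    rcases h.minimal_B.card_inter hcL with h2 | h2 <;>
    rcases h.minimal_D.card_inter hcL with h3 | h3 <;> omega
  rw [hKM] at hK
  rw [hK, show #L = 1 + (#(A ∩ L) + #(B ∩ L) + #(D ∩ L)) by omega] at hcard
  generalize #(A ∩ L) + #(B ∩ L) + #(D ∩ L) = s at *
  nlinarith [Nat.mul_le_mul_left (1 + #A + #B + #D + #M) hint]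

/-- If `R_x ^ k` fixes exactly `x`, `D` and a longest cycle `M`, and some `P` divides the lengths of
the other cycles but not that of `M`, then the class of `x` under `SamePow k` contains `M`. -/
theorem samePow_of_mem_longest (hX : IsConnected X) (h : IsCycleDecomposition x A B D M) {k P : ℕ}
    (hkM : ∀ y ∈ M, (rightTranslation x ^ k) y = y)
    (hkA : ∀ y ∈ A, (rightTranslation x ^ k) y ≠ y)
    (hkB : ∀ y ∈ B, (rightTranslation x ^ k) y ≠ y)
    (hM : ∃ y ∈ M, rightTranslation x y ≠ y) (hAM : #A < #M) (hBM : #B < #M) (hDM : #D ≤ #M)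
    (hA1 : 1 < #A) (hB1 : 1 < #B) (hPA : P ∣ #A) (hPB : P ∣ #B) (hPM : ¬ P ∣ #M) :
    ∀ y ∈ M, SamePow k x y := by
  by_contra! hne
  obtain ⟨v, hvM, hv⟩ := hne
  obtain ⟨u, huM, hu⟩ := hM
  obtain ⟨z, hzx, hz⟩ := hX.exists_samePow_ne (hkM u huM) hu
  obtain ⟨w, hw, hwc⟩ := hX.exists_preserved_class (hkM v hvM) hv
  have hdisj : ∀ y, SamePow k x y → ¬ SamePow k w y := fun y h1 h2 => hw (h1.trans h2.symm)
  simp only [← mem_powClass] at hv hz hw hwc hdisj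
  have hcard := card_powClass_eq hX k x w
  have hdvd := card_powClass_dvd hX x k
  rw [h.card_univ_eq] at hdvd
  have hdisA := disjoint_powClass hkA
  have hdisB := disjoint_powClass hkB
  have hcK := powClass_closed x k
  have hKx := self_mem_powClass k x
  generalize powClass k x = K at *
  generalize powClass k w = L at *
  have hK := h.card_eq K
  have hL := h.card_eq L
  have hcov := h.cover
  have hdisM : Disjoint M K := (h.minimal_M K hcK).resolve_left fun h' => hv (h' hvM)
  have hzD : z ∈ D := by
    rcases hcov z with hy | hy | hy | hy | hy
    · exact absurd hy hzx
    · exact absurd hz (disjoint_left.1 hdisA hy)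
    · exact absurd hz (disjoint_left.1 hdisB hy)
    · exact hy
    · exact absurd hz (disjoint_left.1 hdisM hy)
  have hDK : D ⊆ K := (h.minimal_D K hcK).resolve_right fun h' => disjoint_left.1 h' hzD hz
  have hDL : Disjoint D L := disjoint_left.2 fun y hy => hdisj y (hDK hy)
  rw [if_pos hKx, card_inter_eq_zero hdisA, card_inter_eq_zero hdisB, card_inter_eq_zero hdisM,
    inter_eq_left.2 hDK] at hK
  rw [if_neg (hdisj x hKx), card_inter_eq_zero hDL] at hL
  have hPA' : P ∣ #(A ∩ L) := by
    rcases h.minimal_A.card_inter hwc with h1 | h1 <;> simp [h1.2, hPA]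
  have hPB' : P ∣ #(B ∩ L) := by
    rcases h.minimal_B.card_inter hwc with h1 | h1 <;> simp [h1.2, hPB]
  -- Here `K` is `{x} ∪ D`, so `L` has at most `1 + #M` elements. If `L` contains `M`, there is no
  -- room for `A` or `B`, and `#M` divides `#A + #B < 2 * #M`, forcing equality. Otherwise `L` is
  -- built from `A` and `B` only, and `P` divides `#K`.
  rcases h.minimal_M.card_inter hwc with h1 | h1
  · have hAL : #(A ∩ L) = 0 := by
      rcases h.minimal_A.card_inter hwc with h2 | h2 <;> omega
    have hBL : #(B ∩ L) = 0 := by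
      rcases h.minimal_B.card_inter hwc with h2 | h2 <;> omega
    have hKM : #K = #M := by omega
    rw [hKM, show 1 + #A + #B + #D + #M = (#A + #B) + #M * 2 by omega,
      Nat.dvd_add_left (dvd_mul_right _ _)] at hdvd
    obtain ⟨t, ht⟩ := hdvd
    have ht1 : t = 1 := by
      have : t < 2 := by
        by_contra! h2
        nlinarith
      interval_cases t <;> omega
    rw [ht1, mul_one] at ht
    exact hPM (ht ▸ dvd_add hPA hPB)
  · have hPK : P ∣ #K := by
      rw [hcard, hL, h1.2]
      simpa using dvd_add hPA' hPB'
    have hP := hPK.trans hdvd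
    rw [show 1 + #A + #B + #D + #M = (#A + #B + #K) + #M by omega] at hP
    exact hPM ((Nat.dvd_add_right (dvd_add (dvd_add hPA hPB) hPK)).1 hP)

theorem fixed_closed (x : X) (m : ℕ) :
    ∀ y ∈ ({z | (rightTranslation x ^ m) z = z} : Finset X), rightTranslation x y ∈
      ({z | (rightTranslation x ^ m) z = z} : Finset X) := by
  intro y hy
  simp only [mem_filter, mem_univ, true_and] at hy ⊢
  exact pow_apply_closed x m (rightTranslation_pow_self x m) hy

/-- Otherwise `R_x ^ m` fixes `A` and `B` while `R_x ^ k` fixes the rest, leaving no point moved by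
both. -/
theorem pow_apply_ne_of_mem (hX : IsConnected X) (h : IsCycleDecomposition x A B D M) {k m : ℕ}
    (hkM : ∀ y ∈ M, (rightTranslation x ^ k) y = y)
    (hkD : ∀ y ∈ D, (rightTranslation x ^ k) y = y)
    (hkA : ∀ y ∈ A, (rightTranslation x ^ k) y ≠ y)
    (hmA : ∀ y ∈ A, (rightTranslation x ^ m) y = y)
    (hmM : ∀ y ∈ M, (rightTranslation x ^ m) y ≠ y)
    (hA : A.Nonempty) (hM : M.Nonempty) : ∀ y ∈ B, (rightTranslation x ^ m) y ≠ y := by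
  intro b hb hfix
  have hB : B ⊆ ({z | (rightTranslation x ^ m) z = z} : Finset X) :=
    (h.minimal_B _ (fixed_closed x m)).resolve_right fun h' =>
      disjoint_left.1 h' hb (by simpa using hfix)
  obtain ⟨a, ha⟩ := hA
  obtain ⟨u, hu⟩ := hM
  obtain ⟨y, hyk, hym⟩ := hX.exists_moved_by_both ⟨a, hkA a ha⟩ ⟨u, hmM u hu⟩
  rcases h.cover y with hy | hy | hy | hy | hy
  · exact hyk (hy ▸ rightTranslation_pow_self x k)
  · exact hym (hmA y hy)
  · exact hym (by simpa using hB hy)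
  · exact hyk (hkD y hy)
  · exact hyk (hkM y hy)

/-- The class for `m` avoids `B` and `M`. The bound on products of class sizes keeps it off `A`, so
it is `{x} ∪ D`; size and divisibility constraints then force `D` into the class for `k`. -/
theorem samePow_of_samePow (hX : IsConnected X) (h : IsCycleDecomposition x A B D M) {k m P : ℕ}
    (hkM : ∀ y ∈ M, SamePow k x y)
    (hkD : ∀ y ∈ D, (rightTranslation x ^ k) y = y)
    (hkA : ∀ y ∈ A, (rightTranslation x ^ k) y ≠ y)
    (hkB : ∀ y ∈ B, (rightTranslation x ^ k) y ≠ y)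
    (hmA : ∀ y ∈ A, (rightTranslation x ^ m) y = y)
    (hmM : ∀ y ∈ M, (rightTranslation x ^ m) y ≠ y)
    (hA : ∃ y ∈ A, rightTranslation x y ≠ y) (hM : M.Nonempty)
    (hAM : #A < #M) (hBM : #B < #M) (hDM : #D ≤ #M) (hA1 : 1 < #A)
    (hPA : P ∣ #A) (hPB : P ∣ #B) (hPM : ¬ P ∣ #M) :
    ∀ y, SamePow m x y → SamePow k x y := by
  have hmB := h.pow_apply_ne_of_mem hX (fun y hy => (hkM y hy).pow_apply_eq) hkD hkA hmA hmM
    (hA.imp fun _ h => h.1) hM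
  obtain ⟨a, haA, ha⟩ := hA
  obtain ⟨w, hwx, hw⟩ := hX.exists_samePow_ne (hmA a haA) ha
  simp only [← mem_powClass] at hkM hw ⊢
  have hcard := card_powClass_mul_le hX x k m
  have hdvd := card_powClass_dvd hX x k
  have hdvd' := card_powClass_inter_dvd hX x k m
  have hKx := self_mem_powClass k x
  have hLx := self_mem_powClass m x
  have hdisA := disjoint_powClass hkA
  have hdisB := disjoint_powClass hkB
  have hdisB' := disjoint_powClass hmB
  have hdisM := disjoint_powClass hmM
  have hcK := powClass_closed x k
  have hcL := powClass_closed x m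
  rw [h.card_univ_eq] at hcard hdvd
  have hcov := h.cover
  generalize powClass k x = K at *
  generalize powClass m x = L at *
  have hK := h.card_eq K
  have hL := h.card_eq L
  have hKL := h.card_eq (K ∩ L)
  rw [if_pos hKx, card_inter_eq_zero hdisA, card_inter_eq_zero hdisB,
    inter_eq_left.2 (show M ⊆ K from hkM)] at hK
  rw [if_pos hLx, card_inter_eq_zero hdisB', card_inter_eq_zero hdisM] at hL
  rw [if_pos (mem_inter.2 ⟨hKx, hLx⟩), card_inter_eq_zero (hdisA.mono_right inter_subset_left),
    card_inter_eq_zero (hdisB.mono_right inter_subset_left),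
    card_inter_eq_zero (hdisM.mono_right inter_subset_right)] at hKL
  have hcKL : ∀ y ∈ K ∩ L, rightTranslation x y ∈ K ∩ L := fun y hy =>
    mem_inter.2 ⟨hcK y (mem_inter.1 hy).1, hcL y (mem_inter.1 hy).2⟩
  have hDKL := h.minimal_D.card_inter hcKL
  rcases h.minimal_A.card_inter hcL with ⟨-, hAL⟩ | ⟨hAL, hAL'⟩
  · exfalso
    rcases hDKL with ⟨hD, hD'⟩ | ⟨-, hD'⟩
    · rw [inter_eq_left.2 (hD.trans inter_subset_left)] at hK
      rw [hAL, inter_eq_left.2 (hD.trans inter_subset_right)] at hL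
      rw [hD'] at hKL
      rw [hKL, hL, show 1 + #A + 0 + #D + 0 = #A + (1 + 0 + 0 + #D + 0) by omega,
        Nat.dvd_add_left (dvd_refl _)] at hdvd'
      -- Now `1 + #D ≤ #A`, whereas the product bound reduces to `#A * #M ≤ (1 + #D) * #B`,
      -- impossible as `#B < #M`.
      have hle := Nat.le_of_dvd (by omega) hdvd'
      rw [hK, hL, hKL] at hcard
      nlinarith
    · rw [hK, hL, hKL, hD', hAL] at hcard
      nlinarith [Nat.zero_le (#(D ∩ K)), Nat.zero_le (#(D ∩ L))]
  · have hwD : w ∈ D := by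
      rcases hcov w with hy | hy | hy | hy | hy
      · exact absurd hy hwx
      · exact absurd hw (disjoint_left.1 hAL hy)
      · exact absurd hw (disjoint_left.1 hdisB' hy)
      · exact hy
      · exact absurd hw (disjoint_left.1 hdisM hy)
    have hDL : D ⊆ L := (h.minimal_D L hcL).resolve_right fun h' => disjoint_left.1 h' hwD hw
    rcases h.minimal_D.card_inter hcK with ⟨hDK, -⟩ | ⟨hDK, hDK'⟩
    · intro y hy
      rcases hcov y with hy' | hy' | hy' | hy' | hy'
      · exact hy' ▸ hKx
      · exact absurd hy (disjoint_left.1 hAL hy')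
      · exact absurd hy (disjoint_left.1 hdisB' hy')
      · exact hDK hy'
      · exact hkM y hy'
    · exfalso
      have hDpos : 0 < #D := card_pos.2 ⟨w, hwD⟩
      rw [hDK'] at hK
      rw [hAL', inter_eq_left.2 hDL] at hL
      rw [card_inter_eq_zero (hDK.mono_right inter_subset_left)] at hKL
      rw [hK, hL, hKL] at hcard
      -- The product bound reads `#M * #D ≤ #A + #B < 2 * #M`. Once `#D = 1`, divisibility of the
      -- order by `1 + #M` gives `#A + #B = #M`, against `P`.
      have hD1 : #D = 1 := by
        have : #D < 2 := by
          by_contra! h2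
          nlinarith
        omega
      rw [hK, hD1, show 1 + #A + #B + 1 + #M = (1 + #A + #B) + (1 + 0 + 0 + 0 + #M) by omega,
        Nat.dvd_add_left (dvd_refl _)] at hdvd
      obtain ⟨t, ht⟩ := hdvd
      have ht1 : t = 1 := by
        have : t < 2 := by
          by_contra! h2
          nlinarith
        interval_cases t <;> omega
      rw [ht1] at ht
      exact hPM (show #A + #B = #M by omega ▸ dvd_add hPA hPB)

/-- If `M` is a longest cycle, `R_x ^ k` cannot fix `x`, `M` and one further cycle, and move two
shorter cycles whose lengths are divisible by a number that does not divide the length of `M`. -/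
theorem false_of_moves_two (hX : IsConnected X) (h : IsCycleDecomposition x A B D M)
    {k m n P : ℕ}
    (hkM : ∀ y ∈ M, (rightTranslation x ^ k) y = y)
    (hkD : ∀ y ∈ D, (rightTranslation x ^ k) y = y)
    (hkA : ∀ y ∈ A, (rightTranslation x ^ k) y ≠ y)
    (hkB : ∀ y ∈ B, (rightTranslation x ^ k) y ≠ y)
    (hmA : ∀ y ∈ A, (rightTranslation x ^ m) y = y)
    (hmM : ∀ y ∈ M, (rightTranslation x ^ m) y ≠ y)
    (hnB : ∀ y ∈ B, (rightTranslation x ^ n) y = y)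
    (hnM : ∀ y ∈ M, (rightTranslation x ^ n) y ≠ y)
    (hA : ∃ y ∈ A, rightTranslation x y ≠ y) (hB : ∃ y ∈ B, rightTranslation x y ≠ y)
    (hM : ∃ y ∈ M, rightTranslation x y ≠ y)
    (hAM : #A < #M) (hBM : #B < #M) (hDM : #D ≤ #M) (hA1 : 1 < #A) (hB1 : 1 < #B)
    (hPA : P ∣ #A) (hPB : P ∣ #B) (hPM : ¬ P ∣ #M) : False := by
  have hM' := h.samePow_of_mem_longest hX hkM hkA hkB hM hAM hBM hDM hA1 hB1 hPA hPB hPM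
  have hMn : M.Nonempty := hM.imp fun _ h => h.1
  have h1 := h.samePow_of_samePow hX hM' hkD hkA hkB hmA hmM hA hMn hAM hBM hDM hA1 hPA hPB hPM
  have h2 := h.swap.samePow_of_samePow hX hM' hkD hkB hkA hnB hnM hB hMn hBM hAM hDM hB1 hPB hPA
    hPM
  obtain ⟨a, ha, -⟩ := hA
  -- Every `y` is fixed by the `k`-th, `m`-th or `n`-th power of `R_x`, so `R_y x` always stays in
  -- the class of `x` for `k`.
  refine hkA a ha (hX.samePow_of_forall (fun y => ?_) a).pow_apply_eq
  rcases h.cover y with hy | hy | hy | hy | hy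
  · rw [hy, rightTranslation_self]; rfl
  · exact h1 _ (samePow_apply (hmA y hy))
  · exact h2 _ (samePow_apply (hnB y hy))
  · exact samePow_apply (hkD y hy)
  · exact samePow_apply (hkM y hy)

end IsCycleDecomposition

end Decomposition

/-- A prime power distinguishing the divisors `a` and `N` of `n` splits the divisors of `n`. -/
theorem exists_dvd_or_dvd {n N a : ℕ} (hn : n ≠ 0) (hN : N ∣ n) (ha : a ∣ n) (h : ¬ a ∣ N) :
    ∃ k P : ℕ, N ∣ k ∧ ¬ a ∣ k ∧ ¬ P ∣ N ∧ ∀ t, t ∣ n → t ∣ k ∨ P ∣ t := by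
  have hN0 : N ≠ 0 := ne_zero_of_dvd_ne_zero hn hN
  have ha0 : a ≠ 0 := ne_zero_of_dvd_ne_zero hn ha
  rw [← Nat.factorization_le_iff_dvd ha0 hN0, Finsupp.le_def] at h
  push Not at h
  obtain ⟨p, hp⟩ := h
  have hpp : p.Prime := by
    by_contra hnp
    simp [Nat.factorization_eq_zero_of_not_prime _ hnp] at hp
  have key : ∀ t, t ∣ n → t.factorization p ≤ N.factorization p →
      t ∣ p ^ N.factorization p * (n / p ^ n.factorization p) := by
    intro t ht hle
    rw [← Nat.ordProj_mul_ordCompl_eq_self t p]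
    exact mul_dvd_mul (pow_dvd_pow p hle) (Nat.ordCompl_dvd_ordCompl_of_dvd ht p)
  -- `k` is the largest divisor of `n` with the same `p`-part as `N`; `P` is the first power of `p`
  -- not dividing `N`.
  refine ⟨p ^ N.factorization p * (n / p ^ n.factorization p), p ^ (N.factorization p + 1),
    key N hN le_rfl, fun hak => ?_, fun hPN => ?_, fun t ht => ?_⟩
  · have h1 : p ^ (N.factorization p + 1) ∣ a :=
      (hpp.pow_dvd_iff_le_factorization ha0).2 hp
    have h2 := h1.trans hak
    rw [pow_succ] at h2
    exact Nat.not_dvd_ordCompl hpp hn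
      ((Nat.mul_dvd_mul_iff_left (pow_pos hpp.pos _)).1 h2)
  · have := (hpp.pow_dvd_iff_le_factorization hN0).1 hPN
    omega
  · rcases le_or_gt (t.factorization p) (N.factorization p) with hle | hlt
    · exact Or.inl (key t ht hle)
    · exact Or.inr ((hpp.pow_dvd_iff_le_factorization (ne_zero_of_dvd_ne_zero hn ht)).2 hlt)

/-! ### Cycles of a permutation and their lengths -/

section Orbits

variable {X : Type*} [Fintype X]

/-- The cycle of `f` through `y`, as a set; fixed points form cycles of their own. -/
noncomputable def cycleSet (f : Equiv.Perm X) (y : X) : Finset X := {z | f.SameCycle y z}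

theorem mem_cycleSet {f : Equiv.Perm X} {y z : X} : z ∈ cycleSet f y ↔ f.SameCycle y z := by
  simp [cycleSet]

theorem self_mem_cycleSet (f : Equiv.Perm X) (y : X) : y ∈ cycleSet f y :=
  mem_cycleSet.2 (Equiv.Perm.SameCycle.refl f y)

theorem cycleSet_eq_of_mem {f : Equiv.Perm X} {y z : X} (h : z ∈ cycleSet f y) :
    cycleSet f z = cycleSet f y := by
  rw [mem_cycleSet] at h
  ext w
  rw [mem_cycleSet, mem_cycleSet]
  exact ⟨h.trans, h.symm.trans⟩

theorem disjoint_cycleSet {f : Equiv.Perm X} {y z : X} (h : cycleSet f y ≠ cycleSet f z) :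
    Disjoint (cycleSet f y) (cycleSet f z) :=
  disjoint_left.2 fun _ hy hz => h ((cycleSet_eq_of_mem hy).symm.trans (cycleSet_eq_of_mem hz))

theorem isMinimalFor_cycleSet (f : Equiv.Perm X) (y : X) : IsMinimalFor f (cycleSet f y) := by
  intro S hS
  by_contra! h
  obtain ⟨z, hz, hzS⟩ := not_disjoint_iff.1 h.2
  refine h.1 fun w hw => ?_
  rw [← cycleSet_eq_of_mem hz, mem_cycleSet] at hw
  obtain ⟨i, -, rfl⟩ := hw.exists_pow_eq'
  clear hw
  induction i with
  | zero => exact hzS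
  | succ i ih =>
    rw [pow_succ', Equiv.Perm.mul_apply]
    exact hS _ ih

theorem cycleSet_of_apply_eq {f : Equiv.Perm X} {y : X} (h : f y = y) : cycleSet f y = {y} := by
  ext z
  rw [mem_cycleSet, mem_singleton]
  refine ⟨fun hz => ?_, fun hz => hz ▸ Equiv.Perm.SameCycle.refl f y⟩
  obtain ⟨i, -, rfl⟩ := hz.exists_pow_eq'
  exact Equiv.Perm.pow_apply_eq_self_of_apply_eq_self h i

theorem cycleSet_eq_support [DecidableEq X] {f : Equiv.Perm X} {y : X} (h : f y ≠ y) :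
    cycleSet f y = (f.cycleOf y).support := by
  ext z
  rw [mem_cycleSet, Equiv.Perm.mem_support_cycleOf_iff]
  simp [h]

theorem card_cycleSet_dvd_iff (f : Equiv.Perm X) (y : X) (k : ℕ) :
    #(cycleSet f y) ∣ k ↔ (f ^ k) y = y := by
  by_cases h : f y = y
  · simp [cycleSet_of_apply_eq h, Equiv.Perm.pow_apply_eq_self_of_apply_eq_self h k]
  · have hc := Equiv.Perm.isCycle_cycleOf f h
    rw [cycleSet_eq_support h, ← hc.orderOf, orderOf_dvd_iff_pow_eq_one,
      hc.pow_eq_one_iff' (x := y) (by simpa using h), Equiv.Perm.cycleOf_pow_apply_self]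

theorem pow_apply_eq_of_mem_cycleSet {f : Equiv.Perm X} {y z : X} {k : ℕ} (h : z ∈ cycleSet f y) :
    (f ^ k) z = z ↔ #(cycleSet f y) ∣ k := by
  rw [← card_cycleSet_dvd_iff, cycleSet_eq_of_mem h]

theorem card_image_cycleSet_le [DecidableEq X] (f : Equiv.Perm X) :
    #(univ.image (cycleSet f)) ≤ (cycleStructure f).card := by
  have hsub : univ.image (cycleSet f) ⊆
      f.cycleFactorsFinset.image Equiv.Perm.support ∪ f.supportᶜ.image singleton := by
    intro O hO
    obtain ⟨y, -, rfl⟩ := mem_image.1 hO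
    rw [mem_union, mem_image, mem_image]
    by_cases h : f y = y
    · exact Or.inr ⟨y, by simpa using h, (cycleSet_of_apply_eq h).symm⟩
    · exact Or.inl ⟨f.cycleOf y, Equiv.Perm.cycleOf_mem_cycleFactorsFinset_iff.2 (by simpa using h),
        (cycleSet_eq_support h).symm⟩
  refine (card_le_card hsub).trans ((card_union_le _ _).trans ?_)
  rw [cycleStructure, Equiv.Perm.parts_partition, Equiv.Perm.cycleType_def]
  simp only [Multiset.card_add, Multiset.card_map, Multiset.card_replicate, card_val]
  rw [← card_compl]
  exact add_le_add card_image_le card_image_le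

theorem mem_cycleStructure_iff [DecidableEq X] {f : Equiv.Perm X} {t : ℕ} :
    t ∈ cycleStructure f ↔ ∃ y, #(cycleSet f y) = t := by
  rw [cycleStructure, Equiv.Perm.parts_partition, Multiset.mem_add, Multiset.mem_replicate,
    Equiv.Perm.cycleType_def, Multiset.mem_map, ← card_compl]
  constructor
  · rintro (⟨g, hg, rfl⟩ | ⟨h, rfl⟩)
    · obtain ⟨y, hy⟩ := (Equiv.Perm.mem_cycleFactorsFinset_iff.1 hg).1.nonempty_support
      have hgy := Equiv.Perm.cycle_is_cycleOf hy hg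
      have hyf := Equiv.Perm.mem_cycleFactorsFinset_support_le hg hy
      exact ⟨y, by rw [cycleSet_eq_support (by simpa using hyf), ← hgy]; rfl⟩
    · obtain ⟨y, hy⟩ := card_ne_zero.1 h
      exact ⟨y, by rw [cycleSet_of_apply_eq (by simpa using hy), card_singleton]⟩
  · rintro ⟨y, rfl⟩
    by_cases h : f y = y
    · refine Or.inr ⟨(card_pos.2 ⟨y, by simpa using h⟩).ne', ?_⟩
      rw [cycleSet_of_apply_eq h, card_singleton]
    · exact Or.inl ⟨f.cycleOf y, Equiv.Perm.cycleOf_mem_cycleFactorsFinset_iff.2 (by simpa using h),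
        by rw [cycleSet_eq_support h]; rfl⟩

end Orbits

/-- Pads the list of remaining cycles with `e = ∅`; the last clause keeps the two entries disjoint,
since they can coincide only when empty. -/
theorem exists_subset_pair {α : Type*} (e : α) (Q : Finset α) (hQ : #Q ≤ 2) :
    ∃ b d, (∀ q ∈ Q, q = b ∨ q = d) ∧ (b = e ∨ b ∈ Q) ∧ (d = e ∨ d ∈ Q) ∧ (b = d → b = e) := by
  interval_cases h : #Q
  · exact ⟨e, e, by simp [card_eq_zero.1 h]⟩
  · obtain ⟨b, rfl⟩ := card_eq_one.1 h
    exact ⟨b, e, by simp⟩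
  · obtain ⟨b, d, hbd, rfl⟩ := card_eq_two.1 h
    exact ⟨b, d, by simp [hbd]⟩

/-! ### Divisibility by the longest cycle length -/

variable {X : Type*} [Quandle X] [Fintype X]

theorem exists_cycleDecomposition {x u a : X}
    (hcard : #(univ.image (cycleSet (rightTranslation x))) ≤ 5)
    (hxu : cycleSet (rightTranslation x) x ≠ cycleSet (rightTranslation x) u)
    (hxa : cycleSet (rightTranslation x) x ≠ cycleSet (rightTranslation x) a)
    (hau : cycleSet (rightTranslation x) a ≠ cycleSet (rightTranslation x) u) :
    ∃ B D, (B = ∅ ∨ ∃ b, B = cycleSet (rightTranslation x) b) ∧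
      (D = ∅ ∨ ∃ d, D = cycleSet (rightTranslation x) d) ∧
      IsCycleDecomposition x (cycleSet (rightTranslation x) a) B D
        (cycleSet (rightTranslation x) u) := by
  have hxm := self_mem_cycleSet (rightTranslation x) x
  have hx1 := cycleSet_of_apply_eq (rightTranslation_self x)
  have hmin := isMinimalFor_cycleSet (rightTranslation x)
  have hself := self_mem_cycleSet (rightTranslation x)
  have hdisj := fun y z => disjoint_cycleSet (f := rightTranslation x) (y := y) (z := z)
  generalize cycleSet (rightTranslation x) = c at *
  let Q := (((univ.image c).erase (c x)).erase (c u)).erase (c a)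
  have hQ : #Q ≤ 2 := by
    rw [card_erase_of_mem, card_erase_of_mem, card_erase_of_mem]
    · omega
    · simp
    · simp [hxu.symm]
    · simp [hxa.symm, hau]
  have hmemQ : ∀ O, O ∈ Q ↔ O ≠ c a ∧ O ≠ c u ∧ O ≠ c x ∧ ∃ y, c y = O := by simp [Q]
  obtain ⟨B, D, hcov, hB, hD, hBD⟩ := exists_subset_pair ∅ Q hQ
  have hd : ∀ O, O = ∅ ∨ O ∈ Q → Disjoint (c a) O ∧ Disjoint O (c u) ∧ x ∉ O ∧
      IsMinimalFor (rightTranslation x) O ∧ (O = ∅ ∨ ∃ y, O = c y) := by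
    rintro O (rfl | hO)
    · simp [IsMinimalFor]
    · obtain ⟨h1, h2, h3, y, rfl⟩ := (hmemQ O).1 hO
      exact ⟨hdisj _ _ h1.symm, hdisj _ _ h2, disjoint_left.1 (hdisj _ _ h3.symm) hxm, hmin y,
        Or.inr ⟨y, rfl⟩⟩
  obtain ⟨hB1, hB2, hB3, hB4, hB5⟩ := hd B hB
  obtain ⟨hD1, hD2, hD3, hD4, hD5⟩ := hd D hD
  refine ⟨B, D, hB5, hD5, ⟨fun y => ?_, hB1, hD1, hdisj _ _ hau, ?_, hB2, hD2,
    disjoint_left.1 (hdisj _ _ hxa) hxm, hB3, hD3, disjoint_left.1 (hdisj _ _ hxu) hxm,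
    hmin a, hB4, hD4, hmin u⟩⟩
  · by_cases h1 : c y = c a
    · exact Or.inr (Or.inl (h1 ▸ hself y))
    by_cases h2 : c y = c u
    · exact Or.inr (Or.inr (Or.inr (Or.inr (h2 ▸ hself y))))
    by_cases h3 : c y = c x
    · exact Or.inl (mem_singleton.1 (hx1 ▸ h3 ▸ hself y))
    rcases hcov (c y) ((hmemQ _).2 ⟨h1, h2, h3, y, rfl⟩) with h | h
    · exact Or.inr (Or.inr (Or.inl (h ▸ hself y)))
    · exact Or.inr (Or.inr (Or.inr (Or.inl (h ▸ hself y))))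
  · by_cases h : B = D
    · simp [hBD h]
    rcases hB5 with rfl | ⟨b, rfl⟩
    · simp
    rcases hD5 with rfl | ⟨d, rfl⟩
    · simp
    exact hdisj _ _ h

/-- In a finite connected quandle whose right translations have at most five cycles, the length of
every cycle divides the length of a longest one. -/
theorem card_cycleSet_dvd (hX : IsConnected X) {x u : X}
    (hcard : #(univ.image (cycleSet (rightTranslation x))) ≤ 5)
    (hu : ∀ y, #(cycleSet (rightTranslation x) y) ≤ #(cycleSet (rightTranslation x) u)) (a : X) :
    #(cycleSet (rightTranslation x) a) ∣ #(cycleSet (rightTranslation x) u) := by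
  by_contra ha
  have hpos : ∀ y, 0 < #(cycleSet (rightTranslation x) y) := fun y =>
    card_pos.2 ⟨y, self_mem_cycleSet _ y⟩
  have hdvd : ∀ y, #(cycleSet (rightTranslation x) y) ∣ orderOf (rightTranslation x) := fun y =>
    (card_cycleSet_dvd_iff _ y _).2 (by rw [pow_orderOf_eq_one]; rfl)
  obtain ⟨k, P, huk, hak, hP, hsplit⟩ :=
    exists_dvd_or_dvd (orderOf_pos (rightTranslation x)).ne' (hdvd u) (hdvd a) ha
  have hx1 : #(cycleSet (rightTranslation x) x) = 1 := by
    rw [cycleSet_of_apply_eq (rightTranslation_self x), card_singleton]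
  have hmoved : ∀ y, ¬ #(cycleSet (rightTranslation x) y) ∣ k →
      #(cycleSet (rightTranslation x) y) < #(cycleSet (rightTranslation x) u) ∧
      1 < #(cycleSet (rightTranslation x) y) ∧ P ∣ #(cycleSet (rightTranslation x) y) ∧
      (∀ z ∈ cycleSet (rightTranslation x) y, (rightTranslation x ^ k) z ≠ z) ∧
      (∃ z ∈ cycleSet (rightTranslation x) y, rightTranslation x z ≠ z) ∧
      (∀ z ∈ cycleSet (rightTranslation x) y,
        (rightTranslation x ^ #(cycleSet (rightTranslation x) y)) z = z) ∧
      ∀ z ∈ cycleSet (rightTranslation x) u,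
        (rightTranslation x ^ #(cycleSet (rightTranslation x) y)) z ≠ z := by
    intro y hy
    have hlt : #(cycleSet (rightTranslation x) y) < #(cycleSet (rightTranslation x) u) :=
      lt_of_le_of_ne (hu y) fun h => hy (h ▸ huk)
    have hne : #(cycleSet (rightTranslation x) y) ≠ 1 := fun h => hy (h ▸ one_dvd k)
    have hy0 := hpos y
    refine ⟨hlt, by omega, (hsplit _ (hdvd y)).resolve_left hy,
      fun z hz h => hy ((pow_apply_eq_of_mem_cycleSet hz).1 h),
      ⟨y, self_mem_cycleSet _ y, fun h => hne ?_⟩,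
      fun z hz => (pow_apply_eq_of_mem_cycleSet hz).2 dvd_rfl, fun z hz h => ?_⟩
    · rw [cycleSet_of_apply_eq h, card_singleton]
    · exact absurd (Nat.le_of_dvd hy0 ((pow_apply_eq_of_mem_cycleSet hz).1 h)) (by omega)
  have hfixed : ∀ y, #(cycleSet (rightTranslation x) y) ∣ k →
      ∀ z ∈ cycleSet (rightTranslation x) y, (rightTranslation x ^ k) z = z :=
    fun y hy z hz => (pow_apply_eq_of_mem_cycleSet hz).2 hy
  obtain ⟨haM, ha1, haP, hkA, hA, hmA, hmM⟩ := hmoved a hak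
  have hM : ∃ z ∈ cycleSet (rightTranslation x) u, rightTranslation x z ≠ z := by
    refine ⟨u, self_mem_cycleSet _ u, fun h => ?_⟩
    rw [cycleSet_of_apply_eq h, card_singleton] at haM
    omega
  have hkM := hfixed u huk
  obtain ⟨B, D, hB, hD, hdec⟩ := exists_cycleDecomposition (x := x) (u := u) (a := a) hcard
    (fun h => by rw [← h] at haM; omega) (fun h => by rw [← h] at ha1; omega)
    (fun h => by rw [h] at haM; omega)
  have hcases : ∀ O, (O = ∅ ∨ ∃ y, O = cycleSet (rightTranslation x) y) →
      ((∀ z ∈ O, (rightTranslation x ^ k) z = z) ∧ #O ≤ #(cycleSet (rightTranslation x) u)) ∨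
      ∃ y, O = cycleSet (rightTranslation x) y ∧ ¬ #(cycleSet (rightTranslation x) y) ∣ k := by
    rintro O (rfl | ⟨y, rfl⟩)
    · simp
    · by_cases hy : #(cycleSet (rightTranslation x) y) ∣ k
      · exact Or.inl ⟨hfixed y hy, hu y⟩
      · exact Or.inr ⟨y, rfl, hy⟩
  -- The cases record which of `B` and `D` are moved by `R_x ^ k` besides the cycle of `a`; an empty
  -- set counts as fixed.
  rcases hcases B hB with ⟨hkB, hBM⟩ | ⟨b, rfl, hb⟩ <;>
    rcases hcases D hD with ⟨hkD, hDM⟩ | ⟨d, rfl, hd⟩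
  · obtain ⟨y, hyk, hym⟩ := hX.exists_moved_by_both ⟨a, hkA a (self_mem_cycleSet _ a)⟩
      ⟨u, hmM u (self_mem_cycleSet _ u)⟩
    rcases hdec.cover y with hy | hy | hy | hy | hy
    · exact hyk (hy ▸ rightTranslation_pow_self x k)
    · exact hym (hmA y hy)
    · exact hyk (hkB y hy)
    · exact hyk (hkD y hy)
    · exact hyk (hkM y hy)
  · obtain ⟨hdM, hd1, hdP, hkD, hD, hnD, hnM⟩ := hmoved d hd
    exact hdec.swap_right.false_of_moves_two hX hkM hkB hkA hkD hmA hmM hnD hnM hA hD hM haM hdM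
      hBM ha1 hd1 haP hdP hP
  · obtain ⟨hbM, hb1, hbP, hkB, hB, hnB, hnM⟩ := hmoved b hb
    exact hdec.false_of_moves_two hX hkM hkD hkA hkB hmA hmM hnB hnM hA hB hM haM hbM
      hDM ha1 hb1 haP hbP hP
  · obtain ⟨hbM, hb1, -, hkB, -⟩ := hmoved b hb
    obtain ⟨hdM, hd1, -, hkD, -⟩ := hmoved d hd
    exact hdec.false_of_fixes_only hX hkM hkA hkB hkD hmA hmM hA hM haM hbM hdM ha1.ne' hb1.ne'
      hd1.ne'

end FiniteQuandle

theorem theorem1p4 {X : Type*} [Quandle X] [Fintype X] [DecidableEq X]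
    (hX : FiniteQuandle.IsConnected X) (x : X)
    (c : ℕ) (hc : c = 3 ∨ c = 4 ∨ c = 5)
    (ℓ : Fin c → ℕ) (hℓ : FiniteQuandle.IsProfile x ℓ) :
    ∀ i : Fin c, ℓ i ∣ ℓ ⟨c - 1, by omega⟩ := by
  intro i
  obtain ⟨hmono, hparts⟩ := hℓ
  have hmem : ∀ t, (∃ y, (FiniteQuandle.cycleSet (FiniteQuandle.rightTranslation x) y).card = t) ↔
      ∃ j, ℓ j = t := by
    intro t
    rw [← FiniteQuandle.mem_cycleStructure_iff, ← hparts]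
    simp
  have hcard := FiniteQuandle.card_image_cycleSet_le (FiniteQuandle.rightTranslation x)
  rw [← hparts, Multiset.card_map, Finset.card_val, Finset.card_fin] at hcard
  have hcard5 := hcard.trans (show c ≤ 5 by omega)
  obtain ⟨u, hu⟩ := (hmem _).2 ⟨⟨c - 1, by omega⟩, rfl⟩
  obtain ⟨a, ha⟩ := (hmem _).2 ⟨i, rfl⟩
  rw [← hu, ← ha]
  refine FiniteQuandle.card_cycleSet_dvd hX (le_of_eq_of_le (by congr!) hcard5) (fun y => ?_) a
  obtain ⟨j, hj⟩ := (hmem _).1 ⟨y, rfl⟩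
  rw [← hj, hu]
  exact hmono (Fin.mk_le_mk.2 (by omega))
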